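/- Let $p\ge 2$ be an integer and let $G$ be the Vilenkin group of sequences $x=(x_j)_{j\in\mathbb Z}$, $x_j\in\{0,\dots,p-1\}$, with $x_j\neq 0$ for only finitely many $j<0$, with coordinatewise addition $\oplus$ modulo $p$ (and inverse operation $\ominus$), the topology for which the subgroups $U_l=\{x: x_j=0 \text{ for } j\le l\}$, $l\in\mathbb Z$, form a neighbourhood basis of zero, and the Haar measure $\mu$ with $\mu(U_0)=1$. Put $\|0\|=0$ and $\|x\|=p^{-k}$ if $x_k\ne0$ and $x_j=0$ for $j<k$; let $(Ax)_j=x_{j+1}$; for $k\in\mathbb Z_+$ let $h_{[k]}\in G$ be the element with $x_j=0$ for $j>0$ and $\sum_j x_jp^{-j}=k$. Let $\widehat f$ be the $L^2(G)$-extension of the Fourier transform $\widehat f(\omega)=\int_G f(x)\overline{\chi(x,\omega)}\,d\mu(x)$, $f\in L^1(G)\cap L^2(G)$, where $\chi(x,\omega)=\exp\big(\frac{2\pi i}{p}\sum_j x_j\omega_{1-j}\big)$. For $m\in\mathbb Z_+$ let $W_2^m$ be the set of $f\in L^2(G)$ with $\int_G\|\omega\|^{2k}|\widehat f(\omega)|^2\,d\mu(\omega)<\infty$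 for $k=0,\dots,m$, and let $$\|f\|_{2,m}=\sum_{k=0}^m\Big(\int_G\|\omega\|^{2k}|\widehat f(\omega)|^2\,d\mu(\omega)\Big)^{1/2}.$$ Let $\psi^{(1)},\dots,\psi^{(r)}\in L^2(G)$ be compactly supported and put $\psi^{(\nu)}_{i,k}(x)=p^{i/2}\psi^{(\nu)}(A^ix\ominus h_{[k]})$ for $i\in\mathbb Z$, $k\in\mathbb Z_+$. Suppose that $\{\psi^{(\nu)}_{i,k}\}$ is a tight frame in $L^2(G)$ with frame bound $B>0$, i.e. $\sum_{i\in\mathbb Z}\sum_{k\in\mathbb Z_+}\sum_{\nu=1}^r|\langle f,\psi^{(\nu)}_{i,k}\rangle|^2=B\|f\|_2^2$ for all $f\in L^2(G)$ (the system is not assumed to come from a multiresolution analysis). Then for every $m\in\mathbb Z_+$ there is a constant $C$ such that for all $f\in W_2^m$ and all $j\in\mathbb Z$ the series below converges unconditionally in $L^2(G)$ and $$\Big\|f-\frac1B\sum_{i=-\infty}^{j}\sum_{\nu=1}^r\sum_{k\in\mathbb Z_+}\langle f,\psi^{(\nu)}_{i,k}\rangle\,\psi^{(\nu)}_{i,k}\Big\|_2\le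 C\,p^{-jm}\,\|f\|_{2,m}.$$ (For a frame with bound $B=1$ the factor $1/B$ disappears.) -/

import Mathlib

open MeasureTheory Filter Topology

noncomputable section

namespace Vilenkin

/-- The digit sequences `(x_j)_{j ∈ ℤ}` modulo `p` with at most finitely many nonzero `x_j`, `j < 0`,
under coordinatewise addition modulo `p`. -/
def leftFinite (p : ℕ) : AddSubgroup (ℤ → ZMod p) where
  carrier := {x | ∃ k : ℤ, ∀ j < k, x j = 0}
  zero_mem' := ⟨0, fun _ _ => rfl⟩
  add_mem' := by
    rintro x y ⟨k, hk⟩ ⟨l, hl⟩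
    refine ⟨min k l, fun j hj => ?_⟩
    simp [hk j (lt_of_lt_of_le hj (min_le_left _ _)), hl j (lt_of_lt_of_le hj (min_le_right _ _))]
  neg_mem' := by
    rintro x ⟨k, hk⟩
    exact ⟨k, fun j hj => by simp [hk j hj]⟩

/-- The Vilenkin group `G = G_p`. It is a fresh type, so that it does not inherit the
product topology (its own topology, defined below, is finer). -/
def Vil (p : ℕ) : Type := ↥(leftFinite p)

variable {p : ℕ}

instance : AddCommGroup (Vil p) := inferInstanceAs (AddCommGroup ↥(leftFinite p))

/-- The `j`-th digit of `x`. -/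
def digit (x : Vil p) (j : ℤ) : ZMod p := x.1 j

/-- The element with digits `x`. -/
def ofSeq (x : ℤ → ZMod p) (h : ∃ k : ℤ, ∀ j < k, x j = 0) : Vil p := ⟨x, h⟩

theorem digit_ofSeq (x : ℤ → ZMod p) (h : ∃ k : ℤ, ∀ j < k, x j = 0) (j : ℤ) :
    digit (ofSeq x h) j = x j := rfl

theorem vil_ext {x y : Vil p} (h : ∀ j, digit x j = digit y j) : x = y :=
  Subtype.ext (funext h)

theorem digit_zero (j : ℤ) : digit (0 : Vil p) j = 0 := rfl

theorem digit_add (x y : Vil p) (j : ℤ) : digit (x + y) j = digit x j + digit y j := rfl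

theorem digit_neg (x : Vil p) (j : ℤ) : digit (-x) j = -digit x j := rfl

/-- The subgroups `U_l = {x : x_j = 0 for j ≤ l}`. -/
def U (p : ℕ) (l : ℤ) : AddSubgroup (Vil p) where
  carrier := {x | ∀ j ≤ l, digit x j = 0}
  zero_mem' := fun _ _ => rfl
  add_mem' := fun hx hy j hj => by rw [digit_add, hx j hj, hy j hj, add_zero]
  neg_mem' := fun hx j hj => by rw [digit_neg, hx j hj, neg_zero]

theorem U_anti {l l' : ℤ} (h : l ≤ l') : U p l' ≤ U p l :=
  fun _ hx j hj => hx j (hj.trans h)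

/-- The sets `U_l`, `l ∈ ℤ`, as a basis of neighbourhoods of zero. -/
@[reducible] def zeroBasis (p : ℕ) : AddGroupFilterBasis (Vil p) :=
  addGroupFilterBasisOfComm (Set.range fun l : ℤ => (U p l : Set (Vil p)))
    (Set.range_nonempty _)
    (by
      rintro _ _ ⟨k, rfl⟩ ⟨l, rfl⟩
      exact ⟨_, ⟨max k l, rfl⟩, fun x hx =>
        ⟨U_anti (le_max_left k l) hx, U_anti (le_max_right k l) hx⟩⟩)
    (by rintro _ ⟨k, rfl⟩; exact (U p k).zero_mem)
    (by
      rintro _ ⟨k, rfl⟩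
      refine ⟨_, ⟨k, rfl⟩, ?_⟩
      rintro _ ⟨x, hx, y, hy, rfl⟩
      exact (U p k).add_mem hx hy)
    (by
      rintro _ ⟨k, rfl⟩
      exact ⟨_, ⟨k, rfl⟩, fun x hx => (U p k).neg_mem hx⟩)

/-- The topology of `G`, with the neighbourhood basis `U_l`, `l ∈ ℤ`, of zero. -/
instance : TopologicalSpace (Vil p) := (zeroBasis p).topology

instance : IsTopologicalAddGroup (Vil p) := (zeroBasis p).isTopologicalAddGroup

instance : MeasurableSpace (Vil p) := borel _

instance : BorelSpace (Vil p) := ⟨rfl⟩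

theorem nhds_zero_hasBasis :
    (𝓝 (0 : Vil p)).HasBasis (fun _ : ℤ => True) fun l => (U p l : Set (Vil p)) := by
  have h := (zeroBasis p).nhds_zero_hasBasis
  refine ⟨fun t => (h.mem_iff).trans ?_⟩
  constructor
  · rintro ⟨_, ⟨l, rfl⟩, hl⟩
    exact ⟨l, trivial, hl⟩
  · rintro ⟨l, -, hl⟩
    exact ⟨_, ⟨l, rfl⟩, hl⟩

theorem U_mem_nhds_zero (l : ℤ) : (U p l : Set (Vil p)) ∈ 𝓝 (0 : Vil p) :=
  nhds_zero_hasBasis.mem_of_mem trivial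

/-- The element of `U_0` with prescribed digits `x_1, x_2, …`. -/
def ofDigits (p : ℕ) : (ℕ → ZMod p) →+ Vil p where
  toFun z := ofSeq (fun j => if 1 ≤ j then z (j - 1).toNat else 0)
    ⟨1, fun j hj => by simp [not_le.mpr hj]⟩
  map_zero' := vil_ext fun j => ite_self 0
  map_add' z w := vil_ext fun j => by
    by_cases h : 1 ≤ j <;> simp [digit_add, digit_ofSeq, h]

theorem digit_ofDigits (z : ℕ → ZMod p) (j : ℤ) :
    digit (ofDigits p z) j = if 1 ≤ j then z (j - 1).toNat else 0 := rfl

theorem continuous_ofDigits : Continuous (ofDigits p) := by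
  refine continuous_of_continuousAt_zero (ofDigits p) ?_
  rw [ContinuousAt, map_zero]
  refine nhds_zero_hasBasis.tendsto_right_iff.mpr fun l _ => ?_
  have h : ∀ i ∈ Finset.range l.toNat, ∀ᶠ z : ℕ → ZMod p in 𝓝 0, z i = 0 := fun i _ =>
    IsOpen.mem_nhds ((isOpen_discrete {c : ZMod p | c = 0}).preimage
      (continuous_apply (A := fun _ : ℕ => ZMod p) i)) (Set.mem_ofPred.mpr rfl)
  filter_upwards [(Finset.eventually_all _).mpr h] with z hz j hj
  rw [digit_ofDigits]
  split_ifs with h1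
  · exact hz _ (Finset.mem_range.mpr (by omega))
  · rfl

theorem isCompact_U_zero (p : ℕ) [NeZero p] : IsCompact (U p 0 : Set (Vil p)) := by
  have h : (U p 0 : Set (Vil p)) = Set.range (ofDigits p) := by
    ext x
    constructor
    · intro hx
      refine ⟨fun n => digit x (n + 1), vil_ext fun j => ?_⟩
      rw [digit_ofDigits]
      split_ifs with h1
      · congr 1
        omega
      · exact (hx j (by omega)).symm
    · rintro ⟨z, rfl⟩ j hj
      rw [digit_ofDigits, if_neg (by omega)]
  rw [h]
  exact isCompact_range continuous_ofDigits

/-- The compact open subgroup `U = U_0`. -/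
def compactU (p : ℕ) [NeZero p] : TopologicalSpace.PositiveCompacts (Vil p) where
  carrier := U p 0
  isCompact' := isCompact_U_zero p
  interior_nonempty' := ⟨0, mem_interior_iff_mem_nhds.mpr (U_mem_nhds_zero 0)⟩

/-- The Haar measure `μ` of `G` with `μ(U) = 1`. -/
def haar (p : ℕ) [NeZero p] : Measure (Vil p) := Measure.addHaarMeasure (compactU p)

/-- The space `L²(G)`. -/
abbrev L2 (p : ℕ) [NeZero p] : Type := Lp ℂ 2 (haar p)

/-- `A ^ j` for `j ∈ ℤ`, where `A` is the automorphism `(A x)_i = x_{i+1}`. -/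
def dilation (p : ℕ) (j : ℤ) : Vil p ≃+ Vil p where
  toFun x := ofSeq (fun i => digit x (i + j)) (by
    obtain ⟨k, hk⟩ := x.2
    exact ⟨k - j, fun i hi => hk _ (by omega)⟩)
  invFun x := ofSeq (fun i => digit x (i - j)) (by
    obtain ⟨k, hk⟩ := x.2
    exact ⟨k + j, fun i hi => hk _ (by omega)⟩)
  left_inv x := vil_ext fun i => by simp [digit_ofSeq]
  right_inv x := vil_ext fun i => by simp [digit_ofSeq]
  map_add' _ _ := rfl

theorem digit_dilation (j : ℤ) (x : Vil p) (i : ℤ) :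
    digit (dilation p j x) i = digit x (i + j) := rfl

theorem digit_dilation_symm (j : ℤ) (x : Vil p) (i : ℤ) :
    digit ((dilation p j).symm x) i = digit x (i - j) := rfl

theorem continuous_dilation (j : ℤ) : Continuous (dilation p j) := by
  refine continuous_of_continuousAt_zero (dilation p j) ?_
  rw [ContinuousAt, map_zero]
  refine nhds_zero_hasBasis.tendsto_right_iff.mpr fun l _ => ?_
  filter_upwards [U_mem_nhds_zero (l + j)] with x hx i hi
  rw [digit_dilation]
  exact hx _ (by omega)

theorem continuous_dilation_symm (j : ℤ) : Continuous (dilation p j).symm := by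
  refine continuous_of_continuousAt_zero (dilation p j).symm ?_
  rw [ContinuousAt, map_zero]
  refine nhds_zero_hasBasis.tendsto_right_iff.mpr fun l _ => ?_
  filter_upwards [U_mem_nhds_zero (l - j)] with x hx i hi
  rw [digit_dilation_symm]
  exact hx _ (by omega)

/-- The element `h_[α]` of the discrete subgroup `H`: its digits at `0, -1, -2, …` are the base `p`
digits of `α`, least significant first, so that `∑_j x_j p^{-j} = α`; all other digits vanish. -/
def hElem (p : ℕ) (α : ℕ) : Vil p :=
  ofSeq (fun j => if j ≤ 0 then (((Nat.digits p α).getD (-j).toNat 0 : ℕ) : ZMod p) else 0)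
    ⟨-((Nat.digits p α).length : ℤ), fun j hj => by
      rw [List.getD_eq_default _ _ (by omega)]
      simp⟩

/-- The function `x ↦ p ^ (j / 2) ψ(A ^ j x ⊖ h_[k])`. -/
def waveletFun (ψ : Vil p → ℂ) (j : ℤ) (k : ℕ) (x : Vil p) : ℂ :=
  (((p : ℝ) ^ ((j : ℝ) / 2) : ℝ) : ℂ) * ψ (dilation p j x - hElem p k)

theorem memLp_waveletFun [NeZero p] {ψ : Vil p → ℂ} (hψ : MemLp ψ 2 (haar p)) (j : ℤ) (k : ℕ) :
    MemLp (waveletFun ψ j k) 2 (haar p) := by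
  have : LocallyCompactSpace (Vil p) := (compactU p).locallyCompactSpace_of_addGroup
  have : (haar p).IsAddHaarMeasure := by unfold haar; infer_instance
  have : (haar p).Regular := by unfold haar; infer_instance
  let e : Vil p ≃ₜ Vil p :=
    { (dilation p j).toEquiv with
      continuous_toFun := continuous_dilation j
      continuous_invFun := continuous_dilation_symm j }
  have : ((haar p).map (dilation p j)).IsAddHaarMeasure :=
    (dilation p j).isAddHaarMeasure_map (haar p) (continuous_dilation j)
      (continuous_dilation_symm j)
  have : ((haar p).map (dilation p j)).Regular := Measure.Regular.map e
  have h1 : (haar p).map (dilation p j) = _ • haar p :=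
    Measure.isAddLeftInvariant_eq_smul_of_regular _ _
  have h2 : MemLp (fun y => ψ (y - hElem p k)) 2 (haar p) :=
    hψ.comp_measurePreserving (measurePreserving_sub_right (haar p) (hElem p k))
  have h3 : MemLp (fun y => ψ (y - hElem p k)) 2 ((haar p).map (dilation p j)) := by
    rw [h1]
    exact h2.smul_measure (by simp)
  exact (h3.comp_of_map (continuous_dilation j).measurable.aemeasurable).const_mul _

/-- The system `ψ_{j,k}(x) = p ^ (j / 2) ψ(A ^ j x ⊖ h_[k])` generated by `ψ ∈ L²(G)`. -/
def wavelet [NeZero p] (ψ : L2 p) (j : ℤ) (k : ℕ) : L2 p :=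
  (memLp_waveletFun (Lp.memLp ψ) j k).toLp (waveletFun ψ j k)

/-- The system `{ψ^{(ν)}_{j,k}}` is a tight frame in `L²(G)` with frame bound `B > 0`. -/
def IsTightFrame [NeZero p] {r : ℕ} (ψ : Fin r → L2 p) (B : ℝ) : Prop :=
  0 < B ∧ ∀ f : L2 p,
    HasSum (fun s : ℤ × Fin r × ℕ => ‖inner ℂ (wavelet (ψ s.2.1) s.1 s.2.2) f‖ ^ 2) (B * ‖f‖ ^ 2)

/-- `ψ ∈ L²(G)` has compact support: it vanishes a.e. outside a compact set. -/
def IsCompactlySupported [NeZero p] (ψ : L2 p) : Prop :=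
  ∃ K : Set (Vil p), IsCompact K ∧ ∀ᵐ x ∂haar p, x ∉ K → ψ x = 0

/-- The characters `χ(x, ω) = exp ((2πi / p) ∑_j x_j ω_{1-j})`, with digits read in `{0, …, p - 1}`
(only finitely many summands are nonzero). -/
def character (x ω : Vil p) : ℂ :=
  Complex.exp (2 * Real.pi * Complex.I / p *
    ((∑ᶠ j : ℤ, (digit x j).val * (digit ω (1 - j)).val : ℕ) : ℂ))

/-- The Fourier integral of `f ∈ L¹(G)`. -/
def fourierIntegral [NeZero p] (f : Vil p → ℂ) (ω : Vil p) : ℂ :=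
  ∫ x, f x * (starRingEnd ℂ) (character x ω) ∂haar p

/-- `g` is the Fourier transform of `f ∈ L²(G)`: for some sequence `u_n` in `L¹(G) ∩ L²(G)`
converging to `f` in `L²(G)`, the Fourier integrals of the `u_n` converge to `g` in `L²(G)`. -/
def IsFourierTransform [NeZero p] (f g : L2 p) : Prop :=
  ∃ u : ℕ → Vil p → ℂ, (∀ n, MemLp (u n) 1 (haar p) ∧ MemLp (u n) 2 (haar p)) ∧
    Tendsto (fun n => eLpNorm (fun x => u n x - f x) 2 (haar p)) atTop (𝓝 0) ∧
    Tendsto (fun n => eLpNorm (fun ω => fourierIntegral (u n) ω - g ω) 2 (haar p)) atTop (𝓝 0)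

open Classical in
/-- The Fourier transform on `L²(G)`, i.e. the extension of the Fourier integral from
`L¹(G) ∩ L²(G)` by continuity. By Plancherel's theorem every `f ∈ L²(G)` has exactly one transform
in the sense of `IsFourierTransform`, so the second branch never occurs. -/
def fourier [NeZero p] (f : L2 p) : L2 p :=
  if h : ∃ g, IsFourierTransform f g then h.choose else 0

open Classical in
/-- `‖x‖ = p ^ (-k)` with `k` the least index such that `x_k ≠ 0`, and `‖0‖ = 0`. -/
instance : Norm (Vil p) where
  norm x := if x = 0 then 0 else (p : ℝ) ^ (-sInf {k : ℤ | digit x k ≠ 0})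

/-- The Walsh–Sobolev space `W_2^m`. -/
def sobolev (p : ℕ) [NeZero p] (m : ℕ) : Set (L2 p) :=
  {f | ∀ k ≤ m, Integrable (fun ω => ‖ω‖ ^ (2 * k) * ‖fourier f ω‖ ^ 2) (haar p)}

/-- The norm `‖f‖_{2,m}` of `W_2^m`. -/
def sobolevNorm [NeZero p] (m : ℕ) (f : L2 p) : ℝ :=
  ∑ k ∈ Finset.range (m + 1), √(∫ ω, ‖ω‖ ^ (2 * k) * ‖fourier f ω‖ ^ 2 ∂haar p)

/-- The summand `⟨f, ψ^{(ν)}_{i,k}⟩ ψ^{(ν)}_{i,k}`, with `⟨·,·⟩` linear in its first argument. -/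
def frameTerm [NeZero p] {r : ℕ} (ψ : Fin r → L2 p) (f : L2 p) (i : ℤ) (ν : Fin r) (k : ℕ) : L2 p :=
  (inner ℂ (wavelet (ψ ν) i k) f : ℂ) • wavelet (ψ ν) i k

end Vilenkin

end

noncomputable section

namespace Vilenkin

variable {p : ℕ}

/-! The argument rests on the operator `avg l`, the mean over cosets of `U_l`. It plays the role
that a multiresolution analysis would usually play. It is the orthogonal projection of `L²(G)` onto
the `U_l`-invariant functions, and on the Fourier side it is truncation to `U_{-l}`, the annihilator
of `U_l`.

Frame side. Compact support and tightness force every generator to have mean zero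
(`IsTightFrame.integral_eq_zero`). Test the frame identity on the indicator of `U_0`: at each fine
level `n`, `p^n` wavelets live inside `U_0`, each with squared coefficient `p^{-n} |∫ψ|²`. Every
such level then contributes at least `|∫ψ|²` to a convergent sum. If all generators vanish off
`U_a`, a wavelet of level `i` vanishes off a coset of `U_{a+i}`. Having mean zero, it is killed by
`avg l` whenever `l ≤ a + i`. With `l = a + j + 1`, the coefficients of `f` at all levels `i > j`
are therefore those of `f - avg l f`. The omitted part of the expansion has norm at most `‖f - avg l
f‖` (`norm_sub_partial_expansion_le`).

Fourier side. By Plancherel, `‖f - avg l f‖²` is the integral of `|f̂|²` off `U_{-l}`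
(`IsFourierTransform.norm_sub_avg_sq`). There `‖ω‖ ≥ p^l`, so `‖f - avg l f‖ ≤ p^{-lm} ‖f‖_{2,m}`,
and the constant is `p^{-(a+1)m}`. -/

/-! ### Topology and Haar measure of the subgroups `U_l` -/

theorem exists_mem_U (x : Vil p) : ∃ l, x ∈ U p l := by
  obtain ⟨k, hk⟩ := x.2
  exact ⟨k - 1, fun j hj => hk j (by omega)⟩

theorem isOpen_U (l : ℤ) : IsOpen (U p l : Set (Vil p)) :=
  (U p l).isOpen_of_mem_nhds (U_mem_nhds_zero l)

theorem measurableSet_U (l : ℤ) : MeasurableSet (U p l : Set (Vil p)) :=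
  (isOpen_U l).measurableSet

theorem dilation_mem_U {j l : ℤ} {x : Vil p} : dilation p j x ∈ U p l ↔ x ∈ U p (l + j) := by
  constructor
  · intro h i hi
    have := h (i - j) (by omega)
    rwa [digit_dilation, sub_add_cancel] at this
  · intro h i hi
    rw [digit_dilation]
    exact h _ (by omega)

theorem isCompact_U [NeZero p] (l : ℤ) : IsCompact (U p l : Set (Vil p)) := by
  have h : (U p l : Set (Vil p)) = dilation p (-l) '' (U p 0) := by
    ext x
    constructor
    · intro hx
      refine ⟨(dilation p (-l)).symm x, ?_, by simp⟩
      rw [SetLike.mem_coe, ← add_neg_cancel l, ← dilation_mem_U]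
      simpa using hx
    · rintro ⟨y, hy, rfl⟩
      rw [SetLike.mem_coe, dilation_mem_U]
      simpa using hy
  rw [h]
  exact (isCompact_U_zero p).image (continuous_dilation _)

theorem IsCompact.exists_subset_U {K : Set (Vil p)} (hK : IsCompact K) : ∃ l, K ⊆ U p l := by
  obtain ⟨l, hl⟩ := hK.elim_directed_cover (fun l : ℤ => (U p l : Set (Vil p))) isOpen_U
    (fun x _ => Set.mem_iUnion.mpr (exists_mem_U x))
    (fun a b => ⟨min a b, U_anti (min_le_left a b), U_anti (min_le_right a b)⟩)
  exact ⟨l, hl⟩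

/-- The element whose only possibly nonzero digit is `c` at `j`. -/
def single (j : ℤ) (c : ZMod p) : Vil p :=
  ofSeq (fun i => if i = j then c else 0) ⟨j, fun i hi => by simp [hi.ne]⟩

theorem digit_single (j : ℤ) (c : ZMod p) (i : ℤ) :
    digit (single j c) i = if i = j then c else 0 := rfl

theorem single_mem_U {j l : ℤ} (h : l < j) (c : ZMod p) : single j c ∈ U p l := fun i hi => by
  rw [digit_single, if_neg (by omega)]

/-- Cylinders fixing the digits up to some level form a basis, and each is coded by the level and a
finitely supported digit pattern. Second countability makes continuous functions on `G × G`
measurable for product measures, as the Fubini arguments need. -/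
instance [NeZero p] : SecondCountableTopology (Vil p) := by
  let D : ℤ × (ℤ →₀ ZMod p) → Set (Vil p) := fun a => {x | ∀ j ≤ a.1, digit x j = a.2 j}
  have hD : ∀ a, ∀ x ∈ D a, D a = (fun y => y - x) ⁻¹' (U p a.1 : Set (Vil p)) := by
    intro a x hx
    ext y
    refine forall₂_congr fun j hj => ?_
    change _ ↔ digit (y - x) j = 0
    rw [sub_eq_add_neg, digit_add, digit_neg, hx j hj, ← sub_eq_add_neg, sub_eq_zero]
  have hopen : ∀ a, IsOpen (D a) := by
    intro a
    rw [isOpen_iff_mem_nhds]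
    intro x hx
    rw [hD a x hx]
    exact ((isOpen_U _).preimage (by fun_prop)).mem_nhds (by simp)
  have hb : TopologicalSpace.IsTopologicalBasis (Set.range D) := by
    refine TopologicalSpace.isTopologicalBasis_of_isOpen_of_nhds ?_ ?_
    · rintro _ ⟨a, rfl⟩
      exact hopen a
    · intro x s hx hs
      have h0 : (fun y => y + x) ⁻¹' s ∈ 𝓝 (0 : Vil p) :=
        (hs.preimage (by fun_prop)).mem_nhds (by simpa using hx)
      obtain ⟨l, -, hl⟩ := nhds_zero_hasBasis.mem_iff.mp h0
      obtain ⟨k, hk⟩ := x.2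
      let a : ℤ →₀ ZMod p := Finsupp.onFinset (Finset.Icc k l)
        (fun j => if j ≤ l then digit x j else 0) (fun j hj => by
          rw [Finset.mem_Icc]
          by_contra hc
          refine hj ?_
          split_ifs with h
          · exact hk j (by omega)
          · rfl)
      have hxa : x ∈ D (l, a) := fun j hj => by
        change digit x j = if j ≤ l then digit x j else 0
        rw [if_pos hj]
      refine ⟨D (l, a), ⟨_, rfl⟩, hxa, fun y hy => ?_⟩
      rw [hD _ x hxa] at hy
      simpa using hl hy
  exact hb.secondCountableTopology (Set.countable_range D)

instance [NeZero p] : LocallyCompactSpace (Vil p) :=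
  (compactU p).locallyCompactSpace_of_addGroup

instance [NeZero p] : (haar p).IsAddHaarMeasure := by unfold haar; infer_instance

instance [NeZero p] : (haar p).Regular := by unfold haar; infer_instance

theorem haar_U_lt_top [NeZero p] (l : ℤ) : haar p (U p l) < ⊤ := (isCompact_U l).measure_lt_top

theorem haar_U_zero [NeZero p] : haar p (U p 0) = 1 :=
  Measure.addHaarMeasure_self (K₀ := compactU p)

/-- Sorting by the digit at `l + 1` splits `U_l` into `p` disjoint translates of `U_{l+1}`. -/
theorem haar_real_U_succ [NeZero p] (l : ℤ) :
    (haar p).real (U p l) = p * (haar p).real (U p (l + 1)) := by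
  let s : ZMod p → Set (Vil p) := fun c => (fun x => single (l + 1) c + x) ⁻¹' (U p (l + 1))
  have hU : (U p l : Set (Vil p)) = ⋃ c, s c := by
    ext x
    simp only [Set.mem_iUnion]
    constructor
    · intro hx
      refine ⟨-digit x (l + 1), fun j hj => ?_⟩
      rw [digit_add, digit_single]
      split_ifs with h
      · rw [h, neg_add_cancel]
      · rw [hx j (by omega), zero_add]
    · rintro ⟨c, hc⟩ j hj
      have := hc j (by omega)
      rwa [digit_add, digit_single, if_neg (by omega), zero_add] at this
  have hd : Pairwise (Function.onFun Disjoint s) := by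
    intro c d hcd
    refine Set.disjoint_left.mpr fun x hc hd => hcd ?_
    have h1 := hc (l + 1) le_rfl
    have h2 := hd (l + 1) le_rfl
    rw [digit_add, digit_single, if_pos rfl] at h1 h2
    exact add_right_cancel (h1.trans h2.symm)
  have hm : ∀ c, MeasurableSet (s c) := fun c => (measurableSet_U _).preimage (by fun_prop)
  rw [Measure.real, hU, measure_iUnion hd hm]
  simp only [s, measure_preimage_add, tsum_fintype, Finset.sum_const, Finset.card_univ,
    ZMod.card, nsmul_eq_mul, ENNReal.toReal_mul, ENNReal.toReal_natCast, Measure.real]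

theorem haar_real_U [NeZero p] (l : ℤ) : (haar p).real (U p l) = (p : ℝ) ^ (-l) := by
  have hp : (p : ℝ) ≠ 0 := NeZero.ne _
  induction l using Int.induction_on with
  | zero => simp [Measure.real, haar_U_zero]
  | succ n ih =>
    rw [haar_real_U_succ] at ih
    rw [neg_add, zpow_add₀ hp, ← ih]
    field_simp
  | pred n ih =>
    rw [haar_real_U_succ, sub_add_cancel, ih, neg_sub, sub_eq_add_neg, zpow_add₀ hp]
    simp

/-- By uniqueness of Haar measure only the mass of `U_0` has to be compared, and its preimage under
`A^j` is `U_j`. -/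
theorem map_dilation_haar [NeZero p] (j : ℤ) :
    (haar p).map (dilation p j) = ENNReal.ofReal ((p : ℝ) ^ (-j)) • haar p := by
  let e : Vil p ≃ₜ Vil p :=
    { (dilation p j).toEquiv with
      continuous_toFun := continuous_dilation j
      continuous_invFun := continuous_dilation_symm j }
  have : ((haar p).map (dilation p j)).IsAddHaarMeasure :=
    (dilation p j).isAddHaarMeasure_map (haar p) (continuous_dilation j)
      (continuous_dilation_symm j)
  have : ((haar p).map (dilation p j)).Regular := Measure.Regular.map e
  have h := Measure.addHaarMeasure_unique ((haar p).map (dilation p j)) (compactU p)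
  rw [h]
  congr 1
  change (haar p).map (dilation p j) (U p 0) = _
  rw [Measure.map_apply (continuous_dilation j).measurable (measurableSet_U 0)]
  have : dilation p j ⁻¹' (U p 0 : Set (Vil p)) = U p j := by
    ext x
    simp [dilation_mem_U]
  rw [this, ← haar_real_U, Measure.real, ENNReal.ofReal_toReal (haar_U_lt_top _).ne]

theorem integral_comp_dilation [NeZero p] (j : ℤ) (f : Vil p → ℂ) :
    ∫ x, f (dilation p j x) ∂haar p = ((p : ℝ) ^ (-j) : ℝ) * ∫ x, f x ∂haar p := by
  have he : MeasurableEmbedding (dilation p j) := by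
    let e : Vil p ≃ₜ Vil p :=
      { (dilation p j).toEquiv with
        continuous_toFun := continuous_dilation j
        continuous_invFun := continuous_dilation_symm j }
    exact e.measurableEmbedding
  rw [← he.integral_map, map_dilation_haar, integral_smul_measure,
    ENNReal.toReal_ofReal (by positivity), Complex.real_smul]

theorem le_norm_of_notMem_U [NeZero p] {l : ℤ} {x : Vil p} (hx : x ∉ U p l) :
    (p : ℝ) ^ (-l) ≤ ‖x‖ := by
  have h0 : x ≠ 0 := fun h => hx (h ▸ (U p l).zero_mem)
  have h : ‖x‖ = (p : ℝ) ^ (-sInf {k : ℤ | digit x k ≠ 0}) := if_neg h0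
  rw [h]
  obtain ⟨j, hj, hjx⟩ : ∃ j ≤ l, digit x j ≠ 0 := by
    by_contra hc
    push Not at hc
    exact hx hc
  obtain ⟨k, hk⟩ := exists_mem_U x
  have hb : BddBelow {k : ℤ | digit x k ≠ 0} := ⟨k, fun i hi => by
    by_contra hc
    exact hi (hk i (by omega))⟩
  have h1 : (1 : ℝ) ≤ p := by exact_mod_cast NeZero.one_le
  refine zpow_le_zpow_right₀ h1 (neg_le_neg ?_)
  exact (csInf_le hb hjx).trans hj

/-! ### The duality pairing -/

/-- The pairing `∑ x_j ω_{1-j}`. -/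
def pairing (x ω : Vil p) : ZMod p := ∑ᶠ j : ℤ, digit x j * digit ω (1 - j)

theorem finite_support_pairing (x ω : Vil p) :
    (Function.support fun j : ℤ => digit x j * digit ω (1 - j)).Finite := by
  obtain ⟨a, ha⟩ := exists_mem_U x
  obtain ⟨b, hb⟩ := exists_mem_U ω
  refine (Set.finite_Icc a (1 - b)).subset fun j hj => ?_
  by_contra hc
  rw [Set.mem_Icc, not_and_or, not_le, not_le] at hc
  rcases hc with h | h
  · exact hj (by simp [ha j h.le])
  · exact hj (by simp [hb (1 - j) (by omega)])

theorem pairing_add_left (x y ω : Vil p) : pairing (x + y) ω = pairing x ω + pairing y ω := by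
  simp only [pairing, digit_add, add_mul]
  exact finsum_add_distrib (finite_support_pairing x ω) (finite_support_pairing y ω)

theorem pairing_add_right (x ω η : Vil p) : pairing x (ω + η) = pairing x ω + pairing x η := by
  simp only [pairing, digit_add, mul_add]
  exact finsum_add_distrib (finite_support_pairing x ω) (finite_support_pairing x η)

/-- `x_j` vanishes for `j ≤ l` and `ω_{1-j}` for `j ≥ l + 1`, so every product has a zero factor. -/
theorem pairing_eq_zero {l : ℤ} {x ω : Vil p} (hx : x ∈ U p l) (hω : ω ∈ U p (-l)) :
    pairing x ω = 0 := by
  refine finsum_eq_zero_of_forall_eq_zero fun j => ?_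
  rcases le_or_gt j l with h | h
  · rw [hx j h, zero_mul]
  · rw [hω (1 - j) (by omega), mul_zero]

theorem pairing_single (x : Vil p) (j : ℤ) : pairing x (single (1 - j) 1) = digit x j := by
  rw [pairing, finsum_eq_single _ j]
  · rw [digit_single, if_pos rfl, mul_one]
  · intro i hi
    rw [digit_single, if_neg (by omega), mul_zero]

/-- The integer sum of digit representatives reduces mod `p` to the pairing, and the exponential
depends only on that residue. Bimultiplicativity of `χ` then follows from biadditivity of the
pairing. -/
theorem character_eq [NeZero p] (x ω : Vil p) :
    character x ω = ZMod.stdAddChar (pairing x ω) := by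
  have hfin : (Function.support fun j : ℤ => (digit x j).val * (digit ω (1 - j)).val).Finite := by
    obtain ⟨a, ha⟩ := exists_mem_U x
    obtain ⟨b, hb⟩ := exists_mem_U ω
    refine (Set.finite_Icc a (1 - b)).subset fun j hj => ?_
    by_contra hc
    rw [Set.mem_Icc, not_and_or, not_le, not_le] at hc
    rcases hc with h | h
    · exact hj (by simp [ha j h.le])
    · exact hj (by simp [hb (1 - j) (by omega)])
  have h : pairing x ω =
      ((∑ᶠ j : ℤ, (digit x j).val * (digit ω (1 - j)).val : ℕ) : ZMod p) := by
    rw [pairing]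
    have := (Nat.castAddMonoidHom (ZMod p)).map_finsum hfin
    simp only [Nat.coe_castAddMonoidHom, Nat.cast_mul, ZMod.natCast_val, ZMod.cast_id] at this
    rw [this]
  rw [h, character]
  generalize (∑ᶠ j : ℤ, (digit x j).val * (digit ω (1 - j)).val : ℕ) = n
  have := ZMod.stdAddChar_coe (N := p) n
  rw [Int.cast_natCast] at this
  rw [this, Int.cast_natCast]
  congr 1
  ring

theorem character_add_left [NeZero p] (x y ω : Vil p) :
    character (x + y) ω = character x ω * character y ω := by
  simp only [character_eq, pairing_add_left, AddChar.map_add_eq_mul]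

theorem character_add_right [NeZero p] (x ω η : Vil p) :
    character x (ω + η) = character x ω * character x η := by
  simp only [character_eq, pairing_add_right, AddChar.map_add_eq_mul]

theorem character_eq_one [NeZero p] {l : ℤ} {x ω : Vil p} (hx : x ∈ U p l) (hω : ω ∈ U p (-l)) :
    character x ω = 1 := by
  rw [character_eq, pairing_eq_zero hx hω, AddChar.map_zero_eq_one]

theorem norm_character [NeZero p] (x ω : Vil p) : ‖character x ω‖ = 1 := by
  rw [character_eq, ZMod.stdAddChar_apply, Circle.norm_coe]

theorem character_sub_left [NeZero p] (x y ω : Vil p) :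
    character (x - y) ω = character x ω * (starRingEnd ℂ) (character y ω) := by
  have h := character_add_left (x - y) y ω
  rw [sub_add_cancel] at h
  rw [h, mul_assoc, Complex.mul_conj, Complex.normSq_eq_norm_sq, norm_character]
  simp

/-- `χ` is locally constant: for small increments of both variables, the three extra factors in the
bimultiplicative expansion are `1`. -/
theorem continuous_character [NeZero p] :
    Continuous fun z : Vil p × Vil p => character z.1 z.2 := by
  rw [continuous_iff_continuousAt]
  rintro ⟨x, ω⟩
  obtain ⟨a, ha⟩ := exists_mem_U x
  obtain ⟨b, hb⟩ := exists_mem_U ω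
  have h1 : ∀ᶠ y in 𝓝 x, y - x ∈ U p (max 0 (-b)) := by
    have : Tendsto (fun y => y - x) (𝓝 x) (𝓝 0) := by
      have h : Continuous fun y => y - x := by fun_prop
      simpa using h.tendsto x
    exact this (U_mem_nhds_zero _)
  have h2 : ∀ᶠ η in 𝓝 ω, η - ω ∈ U p (max 0 (-a)) := by
    have : Tendsto (fun y => y - ω) (𝓝 ω) (𝓝 0) := by
      have h : Continuous fun y => y - ω := by fun_prop
      simpa using h.tendsto ω
    exact this (U_mem_nhds_zero _)
  have h : (fun _ => character x ω) =ᶠ[𝓝 (x, ω)] fun z => character z.1 z.2 := by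
    filter_upwards [h1.prod_nhds h2] with z hz
    obtain ⟨h3, h4⟩ := hz
    have e1 : z.1 = x + (z.1 - x) := by abel
    have e2 : z.2 = ω + (z.2 - ω) := by abel
    rw [e1, e2, character_add_left, character_add_right, character_add_right,
      character_eq_one ha (U_anti (le_max_right _ _) h4),
      character_eq_one (l := -b) (U_anti (le_max_right _ _) h3) (by simpa using hb),
      character_eq_one (l := 0) (U_anti (le_max_left _ _) h3)
        (U_anti (by simp) h4)]
    simp
  exact continuousAt_const.congr h

theorem continuous_character_left [NeZero p] (ω : Vil p) : Continuous fun x => character x ω :=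
  continuous_character.comp (by fun_prop : Continuous fun x => (x, ω))

theorem setIntegral_character [NeZero p] (l : ℤ) (x : Vil p) :
    ∫ ω in (U p (-l) : Set (Vil p)), character x ω ∂haar p =
      (U p l : Set (Vil p)).indicator (fun _ => (((p : ℝ) ^ l : ℝ) : ℂ)) x := by
  by_cases hx : x ∈ U p l
  · rw [Set.indicator_of_mem hx, setIntegral_congr_fun (g := fun _ => 1) (measurableSet_U _)
      fun ω hω => character_eq_one hx hω, setIntegral_const, haar_real_U]
    simp
  · rw [Set.indicator_of_notMem (by simpa using hx)]
    obtain ⟨j, hj, hjx⟩ : ∃ j ≤ l, digit x j ≠ 0 := by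
      by_contra hc
      push Not at hc
      exact hx hc
    -- This `v` reads off the nonzero digit `x_j`, so `χ(x, v) ≠ 1`. Translating by `v ∈ U_{-l}`
    -- multiplies the integral by `χ(x, v)` and forces it to vanish.
    set v : Vil p := single (1 - j) 1
    have hv : v ∈ U p (-l) := single_mem_U (by omega) 1
    have hne : character x v ≠ 1 := by
      rw [character_eq, pairing_single, ← AddChar.map_zero_eq_one (ZMod.stdAddChar (N := p))]
      exact fun h => hjx (ZMod.injective_stdAddChar h)
    have h : ∫ ω in (U p (-l) : Set (Vil p)), character x ω ∂haar p =
        character x v * ∫ ω in (U p (-l) : Set (Vil p)), character x ω ∂haar p := by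
      rw [← integral_const_mul, ← integral_indicator (measurableSet_U _),
        ← integral_indicator (measurableSet_U _),
        ← integral_add_left_eq_self (μ := haar p) _ v]
      congr 1
      ext ω
      by_cases hω : ω ∈ U p (-l)
      · rw [Set.indicator_of_mem (by exact (U p (-l)).add_mem hv hω), Set.indicator_of_mem hω,
          character_add_right]
      · rw [Set.indicator_of_notMem (by
          exact fun h => hω (((U p (-l)).add_mem_cancel_left hv).mp h)),
          Set.indicator_of_notMem hω]
    have h2 : (1 - character x v) * ∫ ω in (U p (-l) : Set (Vil p)), character x ω ∂haar p = 0 := by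
      rw [sub_mul, one_mul, ← h, sub_self]
    exact (mul_eq_zero.mp h2).resolve_left (sub_ne_zero.mpr hne.symm)

theorem norm_sq_eq_integral {α : Type*} [MeasurableSpace α] {μ : Measure α} (f : Lp ℂ 2 μ) :
    ‖f‖ ^ 2 = ∫ x, ‖f x‖ ^ 2 ∂μ := by
  have h : ((‖f‖ ^ 2 : ℝ) : ℂ) = ((∫ x, ‖f x‖ ^ 2 ∂μ : ℝ) : ℂ) := by
    have := inner_self_eq_norm_sq_to_K (𝕜 := ℂ) f
    rw [L2.inner_def] at this
    rw [← integral_complex_ofReal]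
    push_cast
    refine this.symm.trans ?_
    congr 1
    ext x
    rw [inner_self_eq_norm_sq_to_K]
    rfl
  exact_mod_cast h

variable [NeZero p]

/-! ### Translations and averages over cosets -/

instance : T2Space (Vil p) := by
  refine IsTopologicalAddGroup.t2Space_of_zero_sep fun x hx => ?_
  obtain ⟨j, hj⟩ : ∃ j, digit x j ≠ 0 := by
    by_contra hc
    push Not at hc
    exact hx (vil_ext hc)
  exact ⟨U p j, U_mem_nhds_zero j, fun h => hj (h j le_rfl)⟩

theorem setIntegral_U_add {E : Type*} [NormedAddCommGroup E] [NormedSpace ℝ E] {l : ℤ} {v : Vil p}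
    (hv : v ∈ U p l) (F : Vil p → E) :
    ∫ h in (U p l : Set (Vil p)), F (h + v) ∂haar p = ∫ h in (U p l : Set (Vil p)), F h ∂haar p := by
  have h := (measurePreserving_add_right (haar p) v).setIntegral_preimage_emb
    (measurableEmbedding_addRight v) F (U p l)
  have hs : (fun x => x + v) ⁻¹' (U p l : Set (Vil p)) = U p l := by
    ext x
    exact (U p l).add_mem_cancel_right hv
  rwa [hs] at h

theorem setIntegral_U_neg {E : Type*} [NormedAddCommGroup E] [NormedSpace ℝ E] (l : ℤ)
    (F : Vil p → E) :
    ∫ h in (U p l : Set (Vil p)), F (-h) ∂haar p = ∫ h in (U p l : Set (Vil p)), F h ∂haar p := by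
  have h := (Measure.measurePreserving_neg (haar p)).setIntegral_preimage_emb
    (MeasurableEquiv.neg (Vil p)).measurableEmbedding F (U p l)
  have hs : Neg.neg ⁻¹' (U p l : Set (Vil p)) = U p l := by
    ext x
    exact (U p l).neg_mem_iff
  rwa [hs] at h

/-- Translation `f ↦ f(· + h)` on `L²(G)`. -/
def translate (h : Vil p) : L2 p →ₗᵢ[ℂ] L2 p :=
  Lp.compMeasurePreservingₗᵢ ℂ (· + h) (measurePreserving_add_right (haar p) h)

theorem translate_toLp (h : Vil p) {u : Vil p → ℂ} (hu : MemLp u 2 (haar p)) :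
    translate h (hu.toLp u) = (hu.comp_measurePreserving
      (measurePreserving_add_right (haar p) h)).toLp (fun x => u (x + h)) :=
  Lp.toLp_compMeasurePreserving hu (measurePreserving_add_right (haar p) h)

theorem coeFn_translate (h : Vil p) (f : L2 p) : translate h f =ᵐ[haar p] fun x => f (x + h) :=
  Lp.coeFn_compMeasurePreserving f (measurePreserving_add_right (haar p) h)

theorem translate_translate (h v : Vil p) (f : L2 p) :
    translate v (translate h f) = translate (h + v) f := by
  refine Lp.ext ?_
  filter_upwards [coeFn_translate v (translate h f), coeFn_translate (h + v) f,
    (measurePreserving_add_right (haar p) v).quasiMeasurePreserving.ae (coeFn_translate h f)]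
    with x h1 h2 h3
  rw [h1, h2, h3, add_assoc, add_comm v h]

theorem translate_zero (f : L2 p) : translate 0 f = f := by
  refine Lp.ext ?_
  filter_upwards [coeFn_translate 0 f] with x h1
  rw [h1, add_zero]

theorem inner_translate_left (h : Vil p) (f g : L2 p) :
    inner ℂ (translate h f) g = inner ℂ f (translate (-h) g) := by
  rw [← (translate (-h)).inner_map_map, translate_translate, add_neg_cancel, translate_zero]

theorem continuous_translate (f : L2 p) : Continuous fun h : Vil p => translate h f := by
  let g : C(Vil p, C(Vil p, Vil p)) :=
    (ContinuousMap.mk (fun a : Vil p × Vil p => a.2 + a.1) (by fun_prop)).curry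
  exact (continuous_const (y := f)).compMeasurePreservingLp g.continuous
    (fun h => measurePreserving_add_right (haar p) h) (by simp)

theorem integrableOn_translate (l : ℤ) (f : L2 p) :
    IntegrableOn (fun h => translate h f) (U p l) (haar p) :=
  (continuous_translate f).continuousOn.integrableOn_compact (isCompact_U l)

/-- The mean of `f` over the cosets of `U_l`. -/
def avg (l : ℤ) (f : L2 p) : L2 p :=
  ((p : ℝ) ^ l) • ∫ h in (U p l : Set (Vil p)), translate h f ∂haar p

theorem cast_zpow_ne_zero (l : ℤ) : (p : ℝ) ^ l ≠ 0 := zpow_ne_zero _ (NeZero.ne _)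

theorem cast_zpow_pos (l : ℤ) : 0 < (p : ℝ) ^ l :=
  zpow_pos (by exact_mod_cast NeZero.pos p) _

theorem smul_setIntegral_const {E : Type*} [NormedAddCommGroup E] [NormedSpace ℝ E]
    [CompleteSpace E] (l : ℤ) (c : E) :
    ((p : ℝ) ^ l) • ∫ _ in (U p l : Set (Vil p)), c ∂haar p = c := by
  rw [setIntegral_const, haar_real_U, smul_smul, ← zpow_add₀ (NeZero.ne _), add_neg_cancel,
    zpow_zero, one_smul]

theorem avg_sub (l : ℤ) (f g : L2 p) : avg l (f - g) = avg l f - avg l g := by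
  simp only [avg, map_sub]
  rw [integral_sub (integrableOn_translate l f) (integrableOn_translate l g), smul_sub]

theorem translate_avg {l : ℤ} {v : Vil p} (hv : v ∈ U p l) (f : L2 p) :
    translate v (avg l f) = avg l f := by
  have h := (translate (p := p) v).toContinuousLinearMap.integral_comp_comm
    (integrableOn_translate l f)
  simp only [LinearIsometry.coe_toContinuousLinearMap, translate_translate] at h
  rw [setIntegral_U_add hv (fun h => translate h f)] at h
  rw [avg, map_real_smul (translate v) (translate v).continuous, ← h]

theorem avg_avg (l : ℤ) (f : L2 p) : avg l (avg l f) = avg l f := by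
  conv_lhs => rw [avg]
  rw [setIntegral_congr_fun (g := fun _ => avg l f) (measurableSet_U l)
    fun v hv => translate_avg hv f, smul_setIntegral_const]

theorem inner_avg_right (l : ℤ) (f g : L2 p) :
    inner ℂ g (avg l f) =
      ((p : ℝ) ^ l) • ∫ h in (U p l : Set (Vil p)), inner ℂ g (translate h f) ∂haar p := by
  rw [avg, inner_smul_right_eq_smul, integral_inner (integrableOn_translate l f)]

/-- Translation by `h` has adjoint translation by `-h`, and `U_l` is symmetric. With `avg_avg` this
makes `avg l` an orthogonal projection. -/
theorem inner_avg_left (l : ℤ) (f g : L2 p) : inner ℂ (avg l f) g = inner ℂ f (avg l g) := by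
  have h : ∀ h : Vil p, (starRingEnd ℂ) (inner ℂ g (translate h f)) =
      inner ℂ f (translate (-h) g) := fun h => by
    rw [inner_conj_symm, inner_translate_left]
  rw [← inner_conj_symm, inner_avg_right, inner_avg_right, Complex.real_smul, Complex.real_smul,
    map_mul, Complex.conj_ofReal, ← integral_conj]
  simp only [h]
  rw [setIntegral_U_neg l fun h => inner ℂ f (translate h g)]

theorem inner_avg_avg (l : ℤ) (f : L2 p) : inner ℂ (avg l f) (avg l f) = inner ℂ (avg l f) f := by
  rw [← inner_avg_left, avg_avg]

theorem norm_sub_avg_sq (l : ℤ) (f : L2 p) :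
    ‖f - avg l f‖ ^ 2 = ‖f‖ ^ 2 - ‖avg l f‖ ^ 2 := by
  have h1 : RCLike.re (inner ℂ f (avg l f)) = ‖avg l f‖ ^ 2 := by
    rw [← inner_avg_left, ← inner_avg_avg, ← norm_sq_eq_re_inner]
  rw [norm_sub_sq (𝕜 := ℂ), h1]
  ring

theorem norm_sub_avg_le (l : ℤ) (f : L2 p) : ‖f - avg l f‖ ≤ ‖f‖ := by
  refine le_of_sq_le_sq ?_ (norm_nonneg _)
  rw [norm_sub_avg_sq]
  nlinarith [sq_nonneg ‖avg l f‖]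

/-- Translation is strongly continuous at `0`, and `U_l` shrinks to `0`. -/
theorem tendsto_avg (f : L2 p) : Tendsto (fun l => avg l f) atTop (𝓝 f) := by
  rw [Metric.tendsto_nhds]
  intro ε hε
  have h0 : ∀ᶠ h in 𝓝 (0 : Vil p), dist (translate h f) f < ε / 2 := by
    have := (continuous_translate f).tendsto 0
    rw [translate_zero] at this
    exact Metric.tendsto_nhds.mp this _ (half_pos hε)
  obtain ⟨L, -, hL⟩ := nhds_zero_hasBasis.mem_iff.mp h0
  filter_upwards [eventually_ge_atTop L] with l hl
  rw [dist_eq_norm]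
  have h1 : avg l f - f = ((p : ℝ) ^ l) •
      ∫ h in (U p l : Set (Vil p)), (translate h f - f) ∂haar p := by
    have hc : IntegrableOn (fun _ => f) (U p l : Set (Vil p)) (haar p) :=
      continuousOn_const.integrableOn_compact (isCompact_U l)
    rw [integral_sub (integrableOn_translate l f) hc, smul_sub, smul_setIntegral_const]
    rfl
  rw [h1, norm_smul, Real.norm_of_nonneg (cast_zpow_pos l).le]
  have h2 : ‖∫ h in (U p l : Set (Vil p)), (translate h f - f) ∂haar p‖ ≤
      ε / 2 * (haar p).real (U p l) := by
    refine norm_setIntegral_le_of_norm_le_const (haar_U_lt_top l) fun h hh => ?_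
    have := hL (U_anti hl hh)
    rw [Set.mem_ofPred, dist_eq_norm] at this
    exact this.le
  rw [haar_real_U, zpow_neg] at h2
  have h3 := mul_le_mul_of_nonneg_left h2 (cast_zpow_pos (p := p) l).le
  have h4 : (p : ℝ) ^ l * (ε / 2 * ((p : ℝ) ^ l)⁻¹) = ε / 2 := by
    field_simp [cast_zpow_ne_zero (p := p) l]
  linarith

/-! ### Plancherel's theorem -/

/-- Writes the quadratic form of `avg l` with its convolution kernel `p^l 1_{U_l}`. The shear `(x,
h) ↦ (x, x + h)` preserves the product measure and turns the average over `h` into a double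
integral. -/
theorem inner_avg_toLp (l : ℤ) {u : Vil p → ℂ} (h1 : Integrable u (haar p))
    (h2 : MemLp u 2 (haar p)) :
    inner ℂ (avg l (h2.toLp u)) (h2.toLp u) =
      ∫ z : Vil p × Vil p, u z.1 * (starRingEnd ℂ) (u z.2) *
        (U p l : Set (Vil p)).indicator (fun _ => (((p : ℝ) ^ l : ℝ) : ℂ)) (z.2 - z.1)
        ∂(haar p).prod (haar p) := by
  set I : Vil p → ℂ := (U p l : Set (Vil p)).indicator (fun _ => (((p : ℝ) ^ l : ℝ) : ℂ)) with hI
  set G : Vil p × Vil p → ℂ := fun z => u z.1 * (starRingEnd ℂ) (u z.2) * I (z.2 - z.1) with hG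
  have hIm : Measurable I := measurable_const.indicator (measurableSet_U l)
  have hIb : ∀ x, ‖I x‖ ≤ (p : ℝ) ^ l := fun x => by
    rw [hI]
    refine (norm_indicator_le_norm_self _ _).trans ?_
    rw [Complex.norm_real, Real.norm_of_nonneg (cast_zpow_pos l).le]
  have hu' : Integrable (fun y => (starRingEnd ℂ) (u y)) (haar p) :=
    (LinearIsometryEquiv.integrable_comp_iff Complex.conjLIE).mpr h1
  have hGi : Integrable G ((haar p).prod (haar p)) := by
    refine (h1.mul_prod hu').mul_bdd (c := (p : ℝ) ^ l) ?_ (ae_of_all _ fun z => hIb _)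
    exact (hIm.comp (measurable_snd.sub measurable_fst)).aestronglyMeasurable
  have hmp : MeasurePreserving (MeasurableEquiv.shearAddRight (Vil p))
      ((haar p).prod (haar p)) ((haar p).prod (haar p)) :=
    measurePreserving_prod_add (haar p) (haar p)
  refine Eq.trans ?_ (hmp.integral_comp' G)
  refine Eq.trans ?_ (integral_prod_symm _ (hmp.integrable_comp_of_integrable hGi)).symm
  simp only [Function.comp_apply]
  rw [← inner_conj_symm, inner_avg_right, Complex.real_smul, map_mul, Complex.conj_ofReal,
    ← integral_conj, ← integral_indicator (measurableSet_U l), ← integral_const_mul]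
  congr 1
  ext h
  have hsimp : ∀ x : Vil p, G (MeasurableEquiv.shearAddRight (Vil p) (x, h)) =
      u x * (starRingEnd ℂ) (u (x + h)) * I h := fun x => by
    change u x * (starRingEnd ℂ) (u (x + h)) * I (x + h - x) = _
    rw [add_sub_cancel_left]
  simp only [hsimp]
  rw [integral_mul_const]
  by_cases hh : h ∈ U p l
  · rw [Set.indicator_of_mem hh, hI, Set.indicator_of_mem (by exact hh), mul_comm]
    congr 1
    rw [inner_conj_symm, translate_toLp, L2.inner_def]
    refine integral_congr_ae ?_
    filter_upwards [h2.coeFn_toLp, (h2.comp_measurePreserving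
      (measurePreserving_add_right (haar p) h)).coeFn_toLp] with x e1 e2
    rw [e1]
    erw [e2]
    rw [RCLike.inner_apply]
    rfl
  · rw [Set.indicator_of_notMem hh, hI, Set.indicator_of_notMem (by exact hh), mul_zero, mul_zero]

/-- By Fubini, allowed since `U_{-l}` has finite measure, the `ω`-integral falls on `χ(z₂ - z₁, ω)`.
Orthogonality of characters produces the same kernel as in `inner_avg_toLp`. -/
theorem setIntegral_fourierIntegral_mul_conj (l : ℤ) {u : Vil p → ℂ}
    (h1 : Integrable u (haar p)) :
    ∫ ω in (U p (-l) : Set (Vil p)),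
        fourierIntegral u ω * (starRingEnd ℂ) (fourierIntegral u ω) ∂haar p =
      ∫ z : Vil p × Vil p, u z.1 * (starRingEnd ℂ) (u z.2) *
        (U p l : Set (Vil p)).indicator (fun _ => (((p : ℝ) ^ l : ℝ) : ℂ)) (z.2 - z.1)
        ∂(haar p).prod (haar p) := by
  have hu' : Integrable (fun y => (starRingEnd ℂ) (u y)) (haar p) :=
    (LinearIsometryEquiv.integrable_comp_iff Complex.conjLIE).mpr h1
  have : IsFiniteMeasure ((haar p).restrict (U p (-l) : Set (Vil p))) :=
    ⟨by simpa using haar_U_lt_top (-l)⟩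
  let F : Vil p → Vil p × Vil p → ℂ := fun ω z =>
    character (z.2 - z.1) ω * (u z.1 * (starRingEnd ℂ) (u z.2))
  have hF : ∀ ω, fourierIntegral u ω * (starRingEnd ℂ) (fourierIntegral u ω) =
      ∫ z, F ω z ∂(haar p).prod (haar p) := by
    intro ω
    rw [fourierIntegral, ← integral_conj, ← integral_prod_mul]
    congr 1
    ext z
    simp only [F, character_sub_left, map_mul, Complex.conj_conj]
    ring
  simp only [hF]
  rw [integral_integral_swap]
  · congr 1
    ext z
    simp only [F]
    rw [integral_mul_const, setIntegral_character, mul_comm]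
  · have hi : Integrable (fun w : Vil p × (Vil p × Vil p) =>
        (1 : ℂ) * (u w.2.1 * (starRingEnd ℂ) (u w.2.2)))
        (((haar p).restrict (U p (-l) : Set (Vil p))).prod ((haar p).prod (haar p))) :=
      (integrable_const (1 : ℂ)).mul_prod (h1.mul_prod hu')
    simp only [one_mul] at hi
    refine hi.bdd_mul (c := 1) ?_ (ae_of_all _ fun w => (norm_character _ _).le)
    exact (continuous_character.comp (by fun_prop : Continuous fun w : Vil p × (Vil p × Vil p) =>
      (w.2.2 - w.2.1, w.1))).aestronglyMeasurable

theorem setIntegral_norm_fourierIntegral_sq (l : ℤ) {u : Vil p → ℂ} (h1 : Integrable u (haar p))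
    (h2 : MemLp u 2 (haar p)) :
    ∫ ω in (U p (-l) : Set (Vil p)), ‖fourierIntegral u ω‖ ^ 2 ∂haar p =
      ‖avg l (h2.toLp u)‖ ^ 2 := by
  have h : ((∫ ω in (U p (-l) : Set (Vil p)), ‖fourierIntegral u ω‖ ^ 2 ∂haar p : ℝ) : ℂ) =
      ((‖avg l (h2.toLp u)‖ ^ 2 : ℝ) : ℂ) := by
    have e : ((‖avg l (h2.toLp u)‖ ^ 2 : ℝ) : ℂ) =
        inner ℂ (avg l (h2.toLp u)) (avg l (h2.toLp u)) := by
      rw [inner_self_eq_norm_sq_to_K]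
      simp
    rw [e, inner_avg_avg, inner_avg_toLp l h1 h2, ← setIntegral_fourierIntegral_mul_conj l h1,
      ← integral_complex_ofReal]
    congr 1
    ext ω
    rw [Complex.mul_conj, Complex.normSq_eq_norm_sq]
  exact_mod_cast h

theorem aestronglyMeasurable_fourierIntegral {u : Vil p → ℂ} (h1 : Integrable u (haar p)) :
    AEStronglyMeasurable (fourierIntegral u) (haar p) := by
  have : AEStronglyMeasurable (fun z : Vil p × Vil p =>
      u z.2 * (starRingEnd ℂ) (character z.2 z.1)) ((haar p).prod (haar p)) := by
    refine h1.aestronglyMeasurable.comp_snd.mul ?_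
    exact (Complex.continuous_conj.comp (continuous_character.comp continuous_swap)
      ).aestronglyMeasurable
  exact this.integral_prod_right'

theorem norm_fourierIntegral_le (u : Vil p → ℂ) (ω : Vil p) :
    ‖fourierIntegral u ω‖ ≤ ∫ x, ‖u x‖ ∂haar p := by
  refine (norm_integral_le_integral_norm _).trans_eq ?_
  congr 1
  ext x
  rw [norm_mul, RCLike.norm_conj, norm_character, mul_one]

theorem aecover_U : AECover (haar p) atTop fun l : ℤ => (U p (-l) : Set (Vil p)) where
  ae_eventually_mem := ae_of_all _ fun x => by
    obtain ⟨l, hl⟩ := exists_mem_U x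
    filter_upwards [eventually_ge_atTop (-l)] with n hn
    exact U_anti (by omega) hl
  measurableSet l := measurableSet_U _

/-- Plancherel: let `l → ∞` in the truncated identity, where `U_{-l}` exhausts `G` and `avg l` tends
to the identity. -/
theorem integrable_norm_fourierIntegral_sq {u : Vil p → ℂ} (h1 : Integrable u (haar p))
    (h2 : MemLp u 2 (haar p)) :
    Integrable (fun ω => ‖fourierIntegral u ω‖ ^ 2) (haar p) ∧
      ∫ ω, ‖fourierIntegral u ω‖ ^ 2 ∂haar p = ‖h2.toLp u‖ ^ 2 := by
  have hi : ∀ l : ℤ, IntegrableOn (fun ω => ‖fourierIntegral u ω‖ ^ 2)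
      (U p (-l) : Set (Vil p)) (haar p) := by
    intro l
    refine Measure.integrableOn_of_bounded (M := (∫ x, ‖u x‖ ∂haar p) ^ 2)
      (haar_U_lt_top _).ne ((aestronglyMeasurable_fourierIntegral h1).norm.pow 2)
      (ae_of_all _ fun ω => ?_)
    rw [Real.norm_of_nonneg (by positivity)]
    exact pow_le_pow_left₀ (norm_nonneg _) (norm_fourierIntegral_le u ω) 2
  have ht : Tendsto (fun l : ℤ => ∫ ω in (U p (-l) : Set (Vil p)),
      ‖fourierIntegral u ω‖ ^ 2 ∂haar p) atTop (𝓝 (‖h2.toLp u‖ ^ 2)) := by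
    simp only [setIntegral_norm_fourierIntegral_sq _ h1 h2]
    exact (tendsto_avg _).norm.pow 2
  exact ⟨aecover_U.integrable_of_integral_tendsto_of_nonneg_ae _ hi
      (ae_of_all _ fun _ => by positivity) ht,
    aecover_U.integral_eq_of_tendsto_of_nonneg_ae _ (ae_of_all _ fun _ => by positivity) hi ht⟩

theorem memLp_fourierIntegral {u : Vil p → ℂ} (h1 : Integrable u (haar p))
    (h2 : MemLp u 2 (haar p)) : MemLp (fourierIntegral u) 2 (haar p) :=
  (memLp_two_iff_integrable_sq_norm (aestronglyMeasurable_fourierIntegral h1)).mpr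
    (integrable_norm_fourierIntegral_sq h1 h2).1

theorem norm_toLp_fourierIntegral {u : Vil p → ℂ} (h1 : Integrable u (haar p))
    (h2 : MemLp u 2 (haar p)) :
    ‖(memLp_fourierIntegral h1 h2).toLp _‖ = ‖h2.toLp u‖ := by
  rw [← sq_eq_sq₀ (norm_nonneg _) (norm_nonneg _),
    ← (integrable_norm_fourierIntegral_sq h1 h2).2, norm_sq_eq_integral]
  refine integral_congr_ae ?_
  filter_upwards [(memLp_fourierIntegral h1 h2).coeFn_toLp] with x hx
  rw [hx]

theorem fourierIntegral_sub {u v : Vil p → ℂ} (hu : Integrable u (haar p))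
    (hv : Integrable v (haar p)) :
    fourierIntegral (u - v) = fourierIntegral u - fourierIntegral v := by
  have h : ∀ {w : Vil p → ℂ}, Integrable w (haar p) → ∀ ω,
      Integrable (fun x => w x * (starRingEnd ℂ) (character x ω)) (haar p) := fun hw ω =>
    hw.mul_bdd (c := 1) (Complex.continuous_conj.comp
      (continuous_character_left ω)).aestronglyMeasurable
      (ae_of_all _ fun x => by rw [RCLike.norm_conj, norm_character])
  ext ω
  simp only [fourierIntegral, Pi.sub_apply, sub_mul]
  exact integral_sub (h hu ω) (h hv ω)

/-- Compactly supported continuous functions are dense, and the isometry makes their transforms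
Cauchy. Hence `fourier` never takes its default value `0`. -/
theorem exists_isFourierTransform (f : L2 p) : ∃ g, IsFourierTransform f g := by
  have hex : ∀ n : ℕ, ∃ u : Vil p → ℂ, Integrable u (haar p) ∧ MemLp u 2 (haar p) ∧
      eLpNorm (fun x => u x - f x) 2 (haar p) ≤ ENNReal.ofReal (1 / (n + 1)) := by
    intro n
    obtain ⟨u, hc, hu, hcont, h2⟩ := (Lp.memLp f).exists_hasCompactSupport_eLpNorm_sub_le
      (by simp) (ε := ENNReal.ofReal (1 / (n + 1)))
      (by simpa using (by positivity : (0 : ℝ) < n + 1))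
    refine ⟨u, hcont.integrable_of_hasCompactSupport hc, h2, ?_⟩
    have e : (fun x => u x - f x) = u - (f : Vil p → ℂ) := rfl
    rwa [e, eLpNorm_sub_comm]
  choose u h1 h2 h3 using hex
  have ht : Tendsto (fun n => eLpNorm (fun x => u n x - f x) 2 (haar p)) atTop (𝓝 0) := by
    refine tendsto_of_tendsto_of_tendsto_of_le_of_le tendsto_const_nhds ?_
      (fun _ => zero_le) h3
    have := ENNReal.tendsto_ofReal (tendsto_one_div_add_atTop_nhds_zero_nat (𝕜 := ℝ))
    simpa using this
  have htL : Tendsto (fun n => (h2 n).toLp (u n)) atTop (𝓝 f) := by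
    have := (Lp.tendsto_Lp_iff_tendsto_eLpNorm'' u h2 f (Lp.memLp f)).mpr ht
    simpa using this
  let V : ℕ → L2 p := fun n => (memLp_fourierIntegral (h1 n) (h2 n)).toLp _
  have hV : ∀ n m, dist (V n) (V m) = dist ((h2 n).toLp (u n)) ((h2 m).toLp (u m)) := by
    intro n m
    rw [dist_eq_norm, dist_eq_norm, ← MemLp.toLp_sub, ← MemLp.toLp_sub,
      ← norm_toLp_fourierIntegral ((h1 n).sub (h1 m)) ((h2 n).sub (h2 m))]
    congr 2
    exact (fourierIntegral_sub (h1 n) (h1 m)).symm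
  have hcau : CauchySeq V := by
    have := htL.cauchySeq
    rw [Metric.cauchySeq_iff] at this ⊢
    simpa only [hV] using this
  obtain ⟨g, hg⟩ := cauchySeq_tendsto_of_complete hcau
  refine ⟨g, u, fun n => ⟨memLp_one_iff_integrable.mpr (h1 n), h2 n⟩, ht, ?_⟩
  have := (Lp.tendsto_Lp_iff_tendsto_eLpNorm'' (fun n => fourierIntegral (u n))
    (fun n => memLp_fourierIntegral (h1 n) (h2 n)) g (Lp.memLp g)).mp (by simpa using hg)
  exact this

theorem isFourierTransform_fourier (f : L2 p) : IsFourierTransform f (fourier f) := by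
  rw [fourier, dif_pos (exists_isFourierTransform f)]
  exact (exists_isFourierTransform f).choose_spec

/-- On the approximating `u_n` this is Plancherel minus its truncated form. Both sides are
continuous in `L²`, so it passes to the limit. -/
theorem IsFourierTransform.norm_sub_avg_sq {f g : L2 p} (h : IsFourierTransform f g) (l : ℤ) :
    ‖f - avg l f‖ ^ 2 = ∫ ω in (U p (-l) : Set (Vil p))ᶜ, ‖g ω‖ ^ 2 ∂haar p := by
  obtain ⟨u, hu, hf, hg⟩ := h
  have h1 : ∀ n, Integrable (u n) (haar p) := fun n => memLp_one_iff_integrable.mp (hu n).1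
  have h2 := fun n => (hu n).2
  have hfL : Tendsto (fun n => (h2 n).toLp (u n)) atTop (𝓝 f) := by
    have := (Lp.tendsto_Lp_iff_tendsto_eLpNorm'' u h2 f (Lp.memLp f)).mpr hf
    simpa using this
  let V : ℕ → L2 p := fun n => (memLp_fourierIntegral (h1 n) (h2 n)).toLp _
  have hgL : Tendsto V atTop (𝓝 g) := by
    have := (Lp.tendsto_Lp_iff_tendsto_eLpNorm'' (fun n => fourierIntegral (u n))
      (fun n => memLp_fourierIntegral (h1 n) (h2 n)) g (Lp.memLp g)).mpr hg
    simpa using this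
  let R := LpToLpRestrictCLM (Vil p) ℂ ℂ (haar p) 2 (U p (-l) : Set (Vil p))ᶜ
  have hR : ∀ w : L2 p, ‖R w‖ ^ 2 = ∫ ω in (U p (-l) : Set (Vil p))ᶜ, ‖w ω‖ ^ 2 ∂haar p := by
    intro w
    rw [norm_sq_eq_integral]
    refine integral_congr_ae ?_
    filter_upwards [LpToLpRestrictCLM_coeFn ℂ (U p (-l) : Set (Vil p))ᶜ w] with x hx
    rw [hx]
  have hV : ∀ n, ‖R (V n)‖ ^ 2 = ‖(h2 n).toLp (u n) - avg l ((h2 n).toLp (u n))‖ ^ 2 := by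
    intro n
    have hi := integrable_norm_fourierIntegral_sq (h1 n) (h2 n)
    have hs := integral_add_compl (measurableSet_U (-l)) hi.1
    rw [setIntegral_norm_fourierIntegral_sq l (h1 n) (h2 n), hi.2] at hs
    rw [hR, Vilenkin.norm_sub_avg_sq, ← hs, add_sub_cancel_left]
    refine integral_congr_ae (ae_restrict_of_ae ?_)
    filter_upwards [(memLp_fourierIntegral (h1 n) (h2 n)).coeFn_toLp] with x hx
    rw [hx]
  have hcont : Continuous fun f : L2 p => f - avg l f := by
    refine (LipschitzWith.of_dist_le_mul (K := 1) fun a b => ?_).continuous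
    rw [dist_eq_norm, dist_eq_norm, NNReal.coe_one, one_mul]
    have : a - avg l a - (b - avg l b) = (a - b) - avg l (a - b) := by
      rw [avg_sub]
      abel
    rw [this]
    exact norm_sub_avg_le l _
  have t1 : Tendsto (fun n => ‖R (V n)‖ ^ 2) atTop (𝓝 (‖R g‖ ^ 2)) :=
    ((R.continuous.tendsto g).comp hgL).norm.pow 2
  have t2 : Tendsto (fun n => ‖R (V n)‖ ^ 2) atTop (𝓝 (‖f - avg l f‖ ^ 2)) := by
    simp only [hV]
    exact ((hcont.tendsto f).comp hfL).norm.pow 2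
  rw [← hR]
  exact tendsto_nhds_unique t2 t1

theorem norm_sub_avg_le_sobolevNorm {m : ℕ} {f : L2 p} (hf : f ∈ sobolev p m) (l : ℤ) :
    ‖f - avg l f‖ ≤ (p : ℝ) ^ (-(l * (m : ℤ))) * sobolevNorm m f := by
  set I := ∫ ω, ‖ω‖ ^ (2 * m) * ‖fourier f ω‖ ^ 2 ∂haar p with hI
  have hle : √I ≤ sobolevNorm m f :=
    Finset.single_le_sum (f := fun k => √(∫ ω, ‖ω‖ ^ (2 * k) * ‖fourier f ω‖ ^ 2 ∂haar p))
      (fun k _ => Real.sqrt_nonneg _) (Finset.self_mem_range_succ m)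
  have hint := hf m le_rfl
  have hn : ∀ ω : Vil p, 0 ≤ ‖ω‖ ^ (2 * m) * ‖fourier f ω‖ ^ 2 := fun ω =>
    mul_nonneg (by rw [pow_mul]; positivity) (by positivity)
  have h1 : ((p : ℝ) ^ (l * (m : ℤ))) ^ 2 * ‖f - avg l f‖ ^ 2 ≤ I := by
    rw [(isFourierTransform_fourier f).norm_sub_avg_sq l, ← integral_const_mul]
    refine le_trans ?_ (setIntegral_le_integral (s := (U p (-l) : Set (Vil p))ᶜ) hint
      (ae_of_all _ hn))
    have hL2 : Integrable (fun ω => ‖fourier f ω‖ ^ 2) (haar p) :=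
      (memLp_two_iff_integrable_sq_norm (Lp.aestronglyMeasurable _)).mp (Lp.memLp _)
    refine setIntegral_mono_on (hL2.const_mul _).integrableOn hint.integrableOn
      (measurableSet_U _).compl fun ω hω => ?_
    refine mul_le_mul_of_nonneg_right ?_ (by positivity)
    -- Off `U_{-l}` one has `‖ω‖ ≥ p^l`, so the weight dominates `p^{2lm}`.
    have := le_norm_of_notMem_U hω
    rw [neg_neg] at this
    calc ((p : ℝ) ^ (l * (m : ℤ))) ^ 2 = ((p : ℝ) ^ l) ^ (2 * m) := by
          rw [zpow_mul, zpow_natCast, ← pow_mul, mul_comm]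
      _ ≤ _ := pow_le_pow_left₀ (cast_zpow_pos l).le this _
  have h2 : (p : ℝ) ^ (l * (m : ℤ)) * ‖f - avg l f‖ ≤ √I := by
    refine Real.le_sqrt_of_sq_le ?_
    rwa [mul_pow]
  rw [zpow_neg, ← div_eq_inv_mul, le_div_iff₀' (cast_zpow_pos _)]
  exact h2.trans hle

/-! ### Tight frame expansions in a Hilbert space -/

section Frame

variable {ι H : Type*} [NormedAddCommGroup H] [InnerProductSpace ℂ H]
  {w : ι → H} {B : ℝ}

/-- A finite linear combination of the members of a Bessel system with bound `B` has norm at most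
`√B` times the `ℓ²` norm of the coefficients. -/
theorem norm_sum_smul_sq_le (hB : 0 ≤ B)
    (hw : ∀ (g : H) (s : Finset ι), ∑ i ∈ s, ‖inner ℂ (w i) g‖ ^ 2 ≤ B * ‖g‖ ^ 2)
    (s : Finset ι) (c : ι → ℂ) :
    ‖∑ i ∈ s, c i • w i‖ ^ 2 ≤ B * ∑ i ∈ s, ‖c i‖ ^ 2 := by
  set v := ∑ i ∈ s, c i • w i with hv
  have h1 : ‖v‖ ^ 2 ≤ ∑ i ∈ s, ‖c i‖ * ‖inner ℂ (w i) v‖ := by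
    have h : ‖v‖ ^ 2 = ‖(inner ℂ v v : ℂ)‖ := by
      rw [inner_self_eq_norm_sq_to_K]
      simp
    rw [h]
    conv_lhs => rw [hv, sum_inner, ← hv]
    refine (norm_sum_le _ _).trans_eq (Finset.sum_congr rfl fun i _ => ?_)
    rw [inner_smul_left, norm_mul, RCLike.norm_conj]
  -- Cauchy–Schwarz, then the Bessel bound applied to `v` itself; a factor `‖v‖²` cancels
  -- afterwards.
  have h2 := Finset.sum_mul_sq_le_sq_mul_sq s (fun i => ‖c i‖) (fun i => ‖inner ℂ (w i) v‖)
  have h3 : (‖v‖ ^ 2) ^ 2 ≤ (∑ i ∈ s, ‖c i‖ ^ 2) * (B * ‖v‖ ^ 2) :=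
    (pow_le_pow_left₀ (by positivity) h1 2).trans
      (h2.trans (mul_le_mul_of_nonneg_left (hw v s) (by positivity)))
  rcases eq_or_ne ‖v‖ 0 with h0 | h0
  · rw [h0, zero_pow two_ne_zero]
    exact mul_nonneg hB (by positivity)
  · have h4 : 0 < ‖v‖ ^ 2 := by positivity
    refine le_of_mul_le_mul_right ?_ h4
    linarith

theorem sum_sq_le_of_tight (hw : ∀ g : H, HasSum (fun i => ‖inner ℂ (w i) g‖ ^ 2) (B * ‖g‖ ^ 2))
    (g : H) (s : Finset ι) : ∑ i ∈ s, ‖inner ℂ (w i) g‖ ^ 2 ≤ B * ‖g‖ ^ 2 :=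
  sum_le_hasSum s (fun _ _ => by positivity) (hw g)

theorem summable_of_tight [CompleteSpace H] (hB : 0 ≤ B)
    (hw : ∀ g : H, HasSum (fun i => ‖inner ℂ (w i) g‖ ^ 2) (B * ‖g‖ ^ 2)) (f : H) :
    Summable fun i => (inner ℂ (w i) f : ℂ) • w i := by
  rw [summable_iff_vanishing_norm]
  intro ε hε
  obtain ⟨s, hs⟩ := summable_iff_vanishing_norm.mp (hw f).summable (ε ^ 2 / (B + 1))
    (by positivity)
  refine ⟨s, fun t ht => ?_⟩
  have h1 := hs t ht
  rw [Real.norm_of_nonneg (by positivity), lt_div_iff₀ (by positivity)] at h1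
  have h2 := norm_sum_smul_sq_le hB (sum_sq_le_of_tight hw) t fun i => inner ℂ (w i) f
  have h3 : 0 ≤ ∑ i ∈ t, ‖inner ℂ (w i) f‖ ^ 2 := by positivity
  refine lt_of_pow_lt_pow_left₀ 2 hε.le ?_
  linarith

/-- The frame operator minus `B` has zero quadratic form, and over `ℂ` this forces an operator to
vanish. -/
theorem hasSum_of_tight [CompleteSpace H] (hB : 0 ≤ B)
    (hw : ∀ g : H, HasSum (fun i => ‖inner ℂ (w i) g‖ ^ 2) (B * ‖g‖ ^ 2)) (f : H) :
    HasSum (fun i => (inner ℂ (w i) f : ℂ) • w i) ((B : ℂ) • f) := by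
  let S : H → H := fun f => ∑' i, (inner ℂ (w i) f : ℂ) • w i
  have hS : ∀ f, HasSum (fun i => (inner ℂ (w i) f : ℂ) • w i) (S f) := fun f =>
    (summable_of_tight hB hw f).hasSum
  let T : H →ₗ[ℂ] H :=
    { toFun := fun f => S f - (B : ℂ) • f
      map_add' := fun f g => by
        have : S (f + g) = S f + S g := by
          refine (hS (f + g)).unique ?_
          simpa only [inner_add_right, add_smul] using (hS f).add (hS g)
        rw [this, smul_add]
        abel
      map_smul' := fun c f => by
        have : S (c • f) = c • S f := by
          refine (hS (c • f)).unique ?_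
          simpa only [inner_smul_right, mul_smul] using (hS f).const_smul c
        rw [this, RingHom.id_apply, smul_sub, smul_comm] }
  have hT : ∀ x, inner ℂ (T x) x = 0 := by
    intro x
    have h1 : HasSum (fun i => (inner ℂ x ((inner ℂ (w i) x : ℂ) • w i) : ℂ)) (inner ℂ x (S x)) :=
      (hS x).mapL (innerSL ℂ x)
    have h2 : HasSum (fun i => ((‖inner ℂ (w i) x‖ ^ 2 : ℝ) : ℂ)) ((B * ‖x‖ ^ 2 : ℝ) : ℂ) :=
      Complex.hasSum_ofReal.mpr (hw x)
    have h3 : (inner ℂ x (S x) : ℂ) = ((B * ‖x‖ ^ 2 : ℝ) : ℂ) := by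
      refine h1.unique ?_
      convert h2 using 2 with i
      rw [inner_smul_right, ← inner_conj_symm x, Complex.mul_conj, Complex.normSq_eq_norm_sq]
    have h4 : inner ℂ x (T x) = 0 := by
      change inner ℂ x (S x - (B : ℂ) • x) = 0
      rw [inner_sub_right, h3, inner_smul_right, inner_self_eq_norm_sq_to_K]
      push_cast
      exact sub_self _
    rw [← inner_conj_symm, h4, map_zero]
  have hT0 : T = 0 := (inner_map_self_eq_zero T).mp hT
  have : S f = (B : ℂ) • f := sub_eq_zero.mp (LinearMap.congr_fun hT0 f)
  exact this ▸ hS f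

/-- If the coefficients of `f` outside the range of `e` are those of `g`, then the partial frame
expansion of `f` over the range of `e` approximates `f` up to `‖g‖`. -/
theorem norm_sub_partial_expansion_le [CompleteSpace H] (hB : 0 < B)
    (hw : ∀ g : H, HasSum (fun i => ‖inner ℂ (w i) g‖ ^ 2) (B * ‖g‖ ^ 2))
    {κ : Type*} {e : κ → ι} (he : Function.Injective e) {f g : H}
    (hfg : ∀ i, i ∉ Set.range e → inner ℂ (w i) f = inner ℂ (w i) g) :
    ‖f - (B⁻¹ : ℂ) • ∑' k, (inner ℂ (w (e k)) f : ℂ) • w (e k)‖ ≤ ‖g‖ := by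
  set F : ι → H := fun i => (inner ℂ (w i) f : ℂ) • w i with hF
  have hs : Summable F := summable_of_tight hB.le hw f
  have hB0 : (B : ℂ) ≠ 0 := by exact_mod_cast hB.ne'
  have h1 : (B : ℂ) • f = ∑' k, F (e k) + ∑' i : ↥(Set.range e)ᶜ, F i := by
    rw [← (hasSum_of_tight hB.le hw f).tsum_eq, ← hs.tsum_subtype_add_tsum_subtype_compl
      (Set.range e), tsum_range F he]
  set R := ∑' i : ↥(Set.range e)ᶜ, F i with hR
  have h2 : f - (B⁻¹ : ℂ) • ∑' k, F (e k) = (B⁻¹ : ℂ) • R := by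
    rw [eq_sub_of_add_eq' h1.symm, smul_sub, smul_smul, inv_mul_cancel₀ hB0, one_smul]
  -- One `B` comes from synthesis, the other from the coefficients, which outside the range of `e`
  -- are those of `g`.
  have h3 : ‖R‖ ^ 2 ≤ B * (B * ‖g‖ ^ 2) := by
    refine le_of_tendsto ((hs.subtype _).hasSum.norm.pow 2) (Eventually.of_forall fun t => ?_)
    have ht : ∑ i ∈ t, (F ∘ Subtype.val) i =
        ∑ i ∈ t.map (Function.Embedding.subtype _), F i := by
      rw [Finset.sum_map]
      rfl
    rw [ht]
    refine (norm_sum_smul_sq_le hB.le (sum_sq_le_of_tight hw) _ _).trans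
      (mul_le_mul_of_nonneg_left ?_ hB.le)
    refine le_trans (le_of_eq (Finset.sum_congr rfl fun i hi => ?_))
      (sum_sq_le_of_tight hw g (t.map (Function.Embedding.subtype _)))
    obtain ⟨a, -, rfl⟩ := Finset.mem_map.mp hi
    rw [hfg ((Function.Embedding.subtype _) a) a.2]
  change ‖f - (B⁻¹ : ℂ) • ∑' k, F (e k)‖ ≤ ‖g‖
  have h4 : ‖R‖ ≤ B * ‖g‖ := by
    refine le_of_sq_le_sq ?_ (by positivity)
    rw [mul_pow]
    linarith
  rw [h2, norm_smul, norm_inv, Complex.norm_real, Real.norm_of_nonneg hB.le,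
    inv_mul_le_iff₀ hB]
  exact h4

end Frame

/-! ### Functions supported in a coset of `U_l` -/

theorem integrable_of_support_coset {w : Vil p → ℂ} (hw : MemLp w 2 (haar p)) {y : Vil p} {l : ℤ}
    (hs : ∀ᵐ x ∂haar p, x - y ∉ U p l → w x = 0) : Integrable w (haar p) := by
  set S : Set (Vil p) := (fun x => x - y) ⁻¹' (U p l) with hS
  have hfin : haar p S < ⊤ := by
    rw [hS, (measurePreserving_sub_right (haar p) y).measure_preimage
      (measurableSet_U l).nullMeasurableSet]
    exact haar_U_lt_top l
  have : IsFiniteMeasure ((haar p).restrict S) := ⟨by simpa using hfin⟩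
  have h : IntegrableOn w S (haar p) := (hw.restrict S).integrable (by norm_num)
  exact h.integrable_of_ae_notMem_eq_zero hs

/-- For `ω ∈ U_{-l}` the character is constant on cosets of `U_l`. -/
theorem fourierIntegral_of_support_coset {w : Vil p → ℂ} {y ω : Vil p} {l : ℤ}
    (hs : ∀ᵐ x ∂haar p, x - y ∉ U p l → w x = 0) (hω : ω ∈ U p (-l)) :
    fourierIntegral w ω = (∫ x, w x ∂haar p) * (starRingEnd ℂ) (character y ω) := by
  rw [fourierIntegral, ← integral_mul_const]
  refine integral_congr_ae ?_
  filter_upwards [hs] with x hx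
  by_cases h : x - y ∈ U p l
  · have : character x ω = character y ω := by
      rw [← sub_add_cancel x y, character_add_left, character_eq_one h hω, one_mul]
    rw [this]
  · rw [hx h, zero_mul, zero_mul]

/-- The transform vanishes on `U_{-l}`, and its `L²` norm there is `‖avg l w‖`. -/
theorem avg_eq_zero {w : Vil p → ℂ} (hw : MemLp w 2 (haar p)) {y : Vil p} {l : ℤ}
    (hs : ∀ᵐ x ∂haar p, x - y ∉ U p l → w x = 0) (h0 : ∫ x, w x ∂haar p = 0) :
    avg l (hw.toLp w) = 0 := by
  have h := setIntegral_norm_fourierIntegral_sq l (integrable_of_support_coset hw hs) hw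
  rw [setIntegral_congr_fun (g := fun _ => 0) (measurableSet_U _) fun ω hω => by
    simp [fourierIntegral_of_support_coset hs hω, h0], integral_zero] at h
  exact norm_eq_zero.mp (pow_eq_zero_iff two_ne_zero |>.mp h.symm)

/-! ### Wavelets with compact support -/

theorem quasiMeasurePreserving_dilation_sub (j : ℤ) (h : Vil p) :
    Measure.QuasiMeasurePreserving (fun x => dilation p j x - h) (haar p) (haar p) := by
  have h1 : Measure.QuasiMeasurePreserving (dilation p j) (haar p) (haar p) :=
    ⟨(continuous_dilation j).measurable, by
      rw [map_dilation_haar]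
      exact Measure.smul_absolutelyContinuous⟩
  exact (measurePreserving_sub_right (haar p) h).quasiMeasurePreserving.comp h1

theorem waveletFun_support {ψ : Vil p → ℂ} {a : ℤ}
    (hψ : ∀ᵐ x ∂haar p, x ∉ U p a → ψ x = 0) (j : ℤ) (k : ℕ) :
    ∀ᵐ x ∂haar p, x - (dilation p j).symm (hElem p k) ∉ U p (a + j) →
      waveletFun ψ j k x = 0 := by
  filter_upwards [(quasiMeasurePreserving_dilation_sub j (hElem p k)).ae hψ] with x hx hn
  rw [waveletFun, hx, mul_zero]
  rwa [← dilation_mem_U, map_sub, AddEquiv.apply_symm_apply] at hn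

theorem integral_waveletFun (ψ : Vil p → ℂ) (j : ℤ) (k : ℕ) :
    ∫ x, waveletFun ψ j k x ∂haar p =
      (((p : ℝ) ^ ((j : ℝ) / 2) * (p : ℝ) ^ (-j) : ℝ) : ℂ) * ∫ x, ψ x ∂haar p := by
  simp only [waveletFun]
  rw [integral_const_mul, integral_comp_dilation j fun y => ψ (y - hElem p k),
    integral_sub_right_eq_self]
  push_cast
  ring

theorem norm_integral_waveletFun_sq (ψ : Vil p → ℂ) (j : ℤ) (k : ℕ) :
    ‖∫ x, waveletFun ψ j k x ∂haar p‖ ^ 2 = (p : ℝ) ^ (-j) * ‖∫ x, ψ x ∂haar p‖ ^ 2 := by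
  have hp : (0 : ℝ) ≤ p := Nat.cast_nonneg p
  have h : ((p : ℝ) ^ ((j : ℝ) / 2)) ^ 2 = (p : ℝ) ^ j := by
    rw [← Real.rpow_natCast, ← Real.rpow_mul hp, ← Real.rpow_intCast]
    congr 1
    push_cast
    ring
  rw [integral_waveletFun, norm_mul, mul_pow, Complex.norm_real, Real.norm_of_nonneg (by positivity),
    mul_pow, h, zpow_neg]
  field_simp [cast_zpow_ne_zero (p := p) j]

/-- `k < p^n` has at most `n` base-`p` digits, at places `1 - n, …, 0`; `A^{-n}` moves them to `1,
…, n`. -/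
theorem dilation_symm_hElem_mem {p : ℕ} (hp : 2 ≤ p) {n k : ℕ} (hk : k < p ^ n) :
    (dilation p n).symm (hElem p k) ∈ U p 0 := by
  intro i hi
  have hl := (Nat.digits_length_le_iff (by omega : 1 < p) k).mpr hk
  rw [digit_dilation_symm, hElem, digit_ofSeq, if_pos (by omega),
    List.getD_eq_default _ _ (by omega), Nat.cast_zero]

/-- These wavelets are supported inside `U_0`, so pairing with its indicator gives their full
integral up to conjugation. -/
theorem norm_inner_wavelet_indicator_sq (hp : 2 ≤ p) {ψ : L2 p} {a : ℤ}
    (hψ : ∀ᵐ x ∂haar p, x ∉ U p a → ψ x = 0) {n k : ℕ} (hn : 0 ≤ a + n) (hk : k < p ^ n) :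
    ‖inner ℂ (wavelet ψ n k)
        (indicatorConstLp 2 (measurableSet_U 0) (haar_U_lt_top 0).ne (1 : ℂ))‖ ^ 2 =
      (p : ℝ) ^ (-(n : ℤ)) * ‖∫ x, ψ x ∂haar p‖ ^ 2 := by
  rw [norm_inner_symm, L2.inner_indicatorConstLp_one, ← norm_integral_waveletFun_sq _ _ k,
    setIntegral_congr_ae (g := waveletFun ψ n k) (measurableSet_U 0)]
  · rw [setIntegral_eq_integral_of_ae_compl_eq_zero]
    filter_upwards [waveletFun_support hψ n k] with x hx hx0
    refine hx fun h => hx0 ?_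
    rw [SetLike.mem_coe, ← sub_add_cancel x ((dilation p n).symm (hElem p k))]
    exact (U p 0).add_mem (U_anti hn h) (dilation_symm_hElem_mem hp hk)
  · filter_upwards [(memLp_waveletFun (Lp.memLp ψ) n k).coeFn_toLp] with x hx _
    exact hx

/-- The generators of a compactly supported tight wavelet frame have vanishing mean. -/
theorem IsTightFrame.integral_eq_zero (hp : 2 ≤ p) {r : ℕ} {ψ : Fin r → L2 p} {B : ℝ}
    (hframe : IsTightFrame ψ B) {ν : Fin r} {a : ℤ}
    (hψ : ∀ᵐ x ∂haar p, x ∉ U p a → ψ ν x = 0) : ∫ x, ψ ν x ∂haar p = 0 := by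
  by_contra hc
  set f : L2 p := indicatorConstLp 2 (measurableSet_U 0) (haar_U_lt_top 0).ne (1 : ℂ)
  -- The shift by `N` ensures `a + n + N ≥ 0`, so the chosen wavelets fit in `U_0`.
  set N : ℕ := (-a).toNat
  have hinj : Function.Injective fun q : ℕ × ℕ =>
      (((q.1 + N : ℕ) : ℤ), ν, q.2) := by
    rintro ⟨a, b⟩ ⟨c, d⟩ h
    simp only [Prod.mk.injEq, Nat.cast_inj, add_left_inj, true_and] at h
    exact Prod.ext h.1 h.2
  have hs : Summable fun q : ℕ × ℕ =>
      ‖inner ℂ (wavelet (ψ ν) ((q.1 + N : ℕ) : ℤ) q.2) f‖ ^ 2 := by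
    have h := (hframe.2 f).summable
    generalize hF : (fun s : ℤ × Fin r × ℕ => ‖inner ℂ (wavelet (ψ s.2.1) s.1 s.2.2) f‖ ^ 2) = F
      at h
    have h' := h.comp_injective hinj
    subst hF
    exact h'
  have hfib := (summable_prod_of_nonneg fun _ => by positivity).mp hs
  have hge : ∀ n : ℕ, ‖∫ x, ψ ν x ∂haar p‖ ^ 2 ≤
      ∑' k : ℕ, ‖inner ℂ (wavelet (ψ ν) ((n + N : ℕ) : ℤ) k) f‖ ^ 2 := by
    intro n
    refine le_trans (le_of_eq ?_) ((hfib.1 n).sum_le_tsum (Finset.range (p ^ (n + N)))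
      fun _ _ => by positivity)
    rw [Finset.sum_congr rfl fun k hk => norm_inner_wavelet_indicator_sq hp hψ
      (n := n + N) (by omega) (Finset.mem_range.mp hk), Finset.sum_const, Finset.card_range,
      nsmul_eq_mul, ← mul_assoc, zpow_neg, zpow_natCast, Nat.cast_pow, mul_inv_cancel₀, one_mul]
    exact pow_ne_zero _ (NeZero.ne _)
  -- The level sums are summable, hence tend to `0`, yet stay above `|∫ψ|²`.
  have hlim := ge_of_tendsto' hfib.2.tendsto_atTop_zero hge
  have : 0 < ‖∫ x, ψ ν x ∂haar p‖ ^ 2 := by positivity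
  linarith

theorem avg_wavelet_eq_zero {ψ : L2 p} {a : ℤ} (hψ : ∀ᵐ x ∂haar p, x ∉ U p a → ψ x = 0)
    (h0 : ∫ x, ψ x ∂haar p = 0) {l j : ℤ} (hj : l ≤ a + j) (k : ℕ) :
    avg l (wavelet ψ j k) = 0 := by
  refine avg_eq_zero (y := (dilation p j).symm (hElem p k)) _ ?_ ?_
  · filter_upwards [waveletFun_support hψ j k] with x hx hn
    exact hx fun h => hn (U_anti hj h)
  · rw [integral_waveletFun, h0, mul_zero]

theorem exists_common_support {r : ℕ} {ψ : Fin r → L2 p} (hsupp : ∀ ν, IsCompactlySupported (ψ ν)) :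
    ∃ a : ℤ, ∀ ν, ∀ᵐ x ∂haar p, x ∉ U p a → ψ ν x = 0 := by
  choose K hK hψ using hsupp
  obtain ⟨a, ha⟩ := IsCompact.exists_subset_U (isCompact_iUnion hK)
  refine ⟨a, fun ν => ?_⟩
  filter_upwards [hψ ν] with x hx hn
  exact hx fun h => hn (ha (Set.mem_iUnion.mpr ⟨ν, h⟩))

end Vilenkin

end

/-! ### The approximation estimate -/

theorem mainTheorem3 (p : ℕ) [NeZero p] (hp : 2 ≤ p) (r : ℕ) (ψ : Fin r → Vilenkin.L2 p) (B : ℝ)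
    (hframe : Vilenkin.IsTightFrame ψ B) (hsupp : ∀ ν, Vilenkin.IsCompactlySupported (ψ ν))
    (m : ℕ) :
    ∃ C : ℝ, ∀ f ∈ Vilenkin.sobolev p m, ∀ j : ℤ,
      Summable (fun s : Set.Iic j × Fin r × ℕ =>
        Vilenkin.frameTerm ψ f (s.1 : ℤ) s.2.1 s.2.2) ∧
      ‖f - (B⁻¹ : ℂ) • ∑' s : Set.Iic j × Fin r × ℕ,
          Vilenkin.frameTerm ψ f (s.1 : ℤ) s.2.1 s.2.2‖
        ≤ C * (p : ℝ) ^ (-(j * (m : ℤ))) * Vilenkin.sobolevNorm m f := by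
  obtain ⟨a, ha⟩ := Vilenkin.exists_common_support hsupp
  refine ⟨(p : ℝ) ^ (-((a + 1) * (m : ℤ))), fun f hf j => ?_⟩
  let w : ℤ × Fin r × ℕ → Vilenkin.L2 p := fun s => Vilenkin.wavelet (ψ s.2.1) s.1 s.2.2
  let e : Set.Iic j × Fin r × ℕ → ℤ × Fin r × ℕ := fun s => ((s.1 : ℤ), s.2)
  have he : Function.Injective e := by
    rintro ⟨a, b⟩ ⟨c, d⟩ h
    simp only [e, Prod.mk.injEq] at h
    exact Prod.ext (Subtype.ext h.1) h.2
  have hw : ∀ g : Vilenkin.L2 p, HasSum (fun i => ‖inner ℂ (w i) g‖ ^ 2) (B * ‖g‖ ^ 2) := hframe.2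
  have hF : ∀ s : Set.Iic j × Fin r × ℕ, Vilenkin.frameTerm ψ f (s.1 : ℤ) s.2.1 s.2.2 =
      (inner ℂ (w (e s)) f : ℂ) • w (e s) := fun _ => rfl
  simp only [hF]
  refine ⟨(Vilenkin.summable_of_tight hframe.1.le hw f).comp_injective he, ?_⟩
  -- The first omitted level is `j + 1`; `l` is the largest index for which `avg l` is known to kill
  -- every wavelet of level `i > j`.
  set l : ℤ := a + j + 1 with hl
  have hfg : ∀ s, s ∉ Set.range e → inner ℂ (w s) f = inner ℂ (w s) (f - Vilenkin.avg l f) := by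
    rintro ⟨i, ν, k⟩ hs
    have hi : j < i := by
      by_contra hc
      exact hs ⟨(⟨i, not_lt.mp hc⟩, ν, k), rfl⟩
    rw [inner_sub_right, ← Vilenkin.inner_avg_left,
      Vilenkin.avg_wavelet_eq_zero (ha ν) (hframe.integral_eq_zero hp (ha ν)) (by omega),
      inner_zero_left, sub_zero]
  refine (Vilenkin.norm_sub_partial_expansion_le hframe.1 hw he hfg).trans
    ((Vilenkin.norm_sub_avg_le_sobolevNorm hf l).trans_eq ?_)
  rw [← zpow_add₀ (NeZero.ne (p : ℝ))]
  congr 2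
  rw [hl]
  ring
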